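/- Let $\lg=\log_2$. A batch of $n$ packets simultaneously starts to contend for a channel using LogLog-Backoff: the window size $w$ takes the values $1,2,4,8,\dots$, and each window of size $w\ge 2$ is executed $\lg\lg w$ times (rounded to an integer $r(w)\ge 0$ in any way with $|r(w)-\lg\lg w|\le 1$; the window of size $1$ is executed any fixed number of times) before $w$ doubles. In every execution of a window of size $w$, each packet that has not yet succeeded chooses one of the $w$ slots of the window uniformly at random, independently of all other choices; the packet succeeds, and leaves, if no other remaining packet chose the same slot. A slot of an execution that is chosen by at least two remaining packets is a collision. Let $\mathcal C$ be the total number of collisions over the whole run. Then $\mathcal C=\Omega\!\left(\frac{n\lg\lg n}{\lg\lg\lg n}\right)$ with high probability: there is a constant $C>0$ such that for every $a>0$ there is an $N$ such that, for all $n\ge N$ and every such rounding $r$, $$\Pr\!\left[\mathcal C\ \ge\ C\,\frac{n\lg\lg n}{\lg\lg\lg n}\right]\ \ge\ 1-\frac1{n^{a}}.$$ -/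

import Mathlib

open MeasureTheory

noncomputable section

/-- Base-two logarithm. -/
def lg (x : ℝ) : ℝ := Real.logb 2 x

namespace LogLogBackoff

/-- The packets of `S` that remain after one execution of a window with `w` slots in which packet
`i` transmits in slot `s i`: a packet succeeds, and leaves, iff no other packet of `S` chose its
slot. -/
def survivors {n w : ℕ} (S : Finset (Fin n)) (s : Fin n → Fin w) : Finset (Fin n) :=
  {i ∈ S | ∃ j ∈ S, j ≠ i ∧ s j = s i}

/-- The number of collisions in one execution of a window with `w` slots: the number of slots
chosen by at least two of the packets of `S`. -/
def collisions {n w : ℕ} (S : Finset (Fin n)) (s : Fin n → Fin w) : ℕ :=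
  Finset.card {t : Fin w | 2 ≤ Finset.card {i ∈ S | s i = t}}

/-- All random choices: `ω (k, j, i)` is the slot that packet `i` picks in the `j`-th execution
(counted from `0`) of the window of size `2 ^ k`. Only the choices of packets that are still
present, in executions that take place, are ever used. -/
abbrev Choices (n : ℕ) : Type := (q : ℕ × ℕ × Fin n) → Fin (2 ^ q.1)

/-- The choices are independent, each one uniform over the slots of its window. -/
def law (n : ℕ) : Measure (Choices n) :=
  Measure.infinitePi fun q : ℕ × ℕ × Fin n => (PMF.uniformOfFintype (Fin (2 ^ q.1))).toMeasure

/-- The slots picked by the packets in the `j`-th execution of the window of size `2 ^ k`. -/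
def slots {n : ℕ} (ω : Choices n) (k j : ℕ) : Fin n → Fin (2 ^ k) := fun i => ω (k, j, i)

/-- The packets that remain after `j` executions of the window of size `2 ^ k`, if those in `S`
were present before the first of them. -/
def afterExecutions {n : ℕ} (ω : Choices n) (k : ℕ) (S : Finset (Fin n)) : ℕ → Finset (Fin n)
  | 0 => S
  | j + 1 => survivors (afterExecutions ω k S j) (slots ω k j)

/-- The packets present when the window size becomes `2 ^ k`. All `n` packets start with window
size `1`; a window of size `w` is executed `reps w` times, and then the size doubles. -/
def presentAt {n : ℕ} (reps : ℕ → ℕ) (ω : Choices n) : ℕ → Finset (Fin n)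
  | 0 => Finset.univ
  | k + 1 => afterExecutions ω k (presentAt reps ω k) (reps (2 ^ k))

/-- The total number of collisions over the whole run. -/
def totalCollisions {n : ℕ} (reps : ℕ → ℕ) (ω : Choices n) : ENNReal :=
  ∑' k : ℕ, ∑ j ∈ Finset.range (reps (2 ^ k)),
    (collisions (afterExecutions ω k (presentAt reps ω k) j) (slots ω k j) : ENNReal)

/-- `reps w` is `lg lg w`, rounded to an integer in some way (down, up, to the nearest, up to at
least `1`, ...). At `w = 1`, where `lg lg w` is undefined, any number of executions is allowed. -/
def IsLogLog (reps : ℕ → ℕ) : Prop :=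
  ∀ w : ℕ, 2 ≤ w → |(reps w : ℝ) - lg (lg w)| ≤ 1

end LogLogBackoff

end

/-!
While more than `w` packets are present, an execution of a window of size `w` has at most `w - 1`
successes. As window sizes grow geometrically, the windows of size at most
`n / (20 lg lg n lg lg lg n)` together remove only a small fraction of the packets, and about
`lg lg lg n` further doublings lead to a window size of order `n / lg lg lg n`. In the windows in
between, while half of the packets remain, a slot is chosen by at least a constant times
`lg lg lg n` packets on average. For `t` slots to be free of collisions, all but `t` of the packets
have to avoid these slots, and a union bound over the sets of `t` slots and of `t` packets shows
that for `t ≈ n / (lg lg n) ^ 2` this has probability at most `exp (-t)`. As a success uses up a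
slot free of collisions, half of the packets are then still present in the last of these windows,
and most slots in each of its about `lg lg n` executions are collisions.
-/

namespace LogLogBackoff

open Finset Filter ProbabilityTheory

section OneExecution

variable {ι κ : Type*} [Fintype κ] [DecidableEq κ] {S : Finset ι} {s : ι → κ} {n w t : ℕ}

/-- The slots chosen by at most one packet of `S`. They bound both the successes from above and the
collisions from below. -/
def collisionFreeSlots (S : Finset ι) (s : ι → κ) : Finset κ :=
  {x | #{i ∈ S | s i = x} ≤ 1}

lemma card_filter_eq_le_one_of_mem_collisionFreeSlots {x : κ} (hx : x ∈ collisionFreeSlots S s) :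
    #{i ∈ S | s i = x} ≤ 1 :=
  (mem_filter.1 hx).2

lemma card_collisionFreeSlots_lt_of_card_lt (h : Fintype.card κ < #S) :
    #(collisionFreeSlots S s) < Fintype.card κ := by
  obtain ⟨x, -, hx⟩ := exists_lt_card_fiber_of_mul_lt_card_of_maps_to (n := 1) (f := s)
    (fun i _ => mem_univ (s i)) (by rwa [card_univ, mul_one])
  exact card_lt_univ_of_notMem fun hfree =>
    hx.not_ge (card_filter_eq_le_one_of_mem_collisionFreeSlots hfree)

lemma collisions_add_card_collisionFreeSlots (S : Finset (Fin n)) (s : Fin n → Fin w) :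
    collisions S s + #(collisionFreeSlots S s) = w := by
  simpa only [collisions, collisionFreeSlots, not_le, Nat.lt_succ_iff, card_univ, Fintype.card_fin]
    using card_filter_add_card_filter_not (s := (univ : Finset (Fin w)))
      fun x => 2 ≤ #{i ∈ S | s i = x}

lemma card_le_card_survivors_add_card_collisionFreeSlots (S : Finset (Fin n)) (s : Fin n → Fin w) :
    #S ≤ #(survivors S s) + #(collisionFreeSlots S s) := by
  have hsplit := card_filter_add_card_filter_not (s := S) fun i => ∃ j ∈ S, j ≠ i ∧ s j = s i
  have alone {i j : Fin n} (hi : i ∈ S.filter fun i => ¬∃ j ∈ S, j ≠ i ∧ s j = s i) (hj : j ∈ S)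
      (hij : s j = s i) : j = i :=
    not_not.1 fun hne => (mem_filter.1 hi).2 ⟨j, hj, hne, hij⟩
  have hsuccesses : #(S.filter fun i => ¬∃ j ∈ S, j ≠ i ∧ s j = s i) ≤
      #(collisionFreeSlots S s) := by
    refine card_le_card_of_injOn s (fun i hi => ?_) fun i hi j hj hij =>
      alone hj (mem_filter.1 hi).1 hij
    refine mem_filter.2 ⟨mem_univ _, card_le_one.2 fun a ha b hb => ?_⟩
    rw [mem_filter] at ha hb
    exact (alone hi ha.1 ha.2).trans (alone hi hb.1 hb.2).symm
  unfold survivors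
  lia

lemma exists_slots_avoided_outside (htS : t ≤ #S) (htfree : t ≤ #(collisionFreeSlots S s)) :
    ∃ T : Finset κ, ∃ A ⊆ S, #T = t ∧ #A = t ∧ ∀ i ∈ S, i ∉ A → s i ∉ T := by
  obtain ⟨T, hTfree, hT⟩ := exists_subset_card_eq htfree
  have hcard : #{i ∈ S | s i ∈ T} ≤ t := by
    rw [← hT, ← one_mul #T]
    refine card_le_mul_card_image_of_maps_to (f := s) (fun i hi => (mem_filter.1 hi).2) 1
      fun x hx => ?_
    exact (card_le_card (filter_subset_filter _ (filter_subset _ S))).trans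
      (card_filter_eq_le_one_of_mem_collisionFreeSlots (hTfree hx))
  obtain ⟨A, hA, hAS, hAt⟩ := exists_subsuperset_card_eq (filter_subset _ S) hcard htS
  exact ⟨T, A, hAS, hT, hAt, fun i hi hiA hiT => hiA (hA (mem_filter.2 ⟨hi, hiT⟩))⟩

end OneExecution

section Binomial

variable {n m w t : ℕ}

lemma choose_le_div_mul_exp_one_pow (n t : ℕ) : (n.choose t : ℝ) ≤ (n / t * Real.exp 1) ^ t := by
  have ht : (t : ℝ) ^ t ≠ 0 := by exact_mod_cast t.pow_self_pos.ne'
  calc (n.choose t : ℝ) ≤ (n : ℝ) ^ t / t.factorial := Nat.choose_le_pow_div t n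
    _ = (n / t : ℝ) ^ t * ((t : ℝ) ^ t / t.factorial) := by
      rw [div_pow]
      field_simp
    _ ≤ (n / t : ℝ) ^ t * Real.exp t := by
      gcongr
      exact Real.pow_div_factorial_le_exp _ t.cast_nonneg t
    _ = (n / t * Real.exp 1) ^ t := by rw [mul_pow, Real.exp_one_pow]

lemma one_sub_div_pow_sub_le_exp_pow (htw : t ≤ w) (hnm : n ≤ 2 * m) (htn : 4 * t ≤ n) :
    (1 - t / w : ℝ) ^ (m - t) ≤ Real.exp (-(n / (4 * w))) ^ t := by
  have hmt : (n : ℝ) / 4 ≤ (m - t : ℕ) := by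
    rw [div_le_iff₀ four_pos]
    exact_mod_cast (by lia : n ≤ (m - t) * 4)
  have hnonneg : (0 : ℝ) ≤ 1 - t / w :=
    sub_nonneg.2 (div_le_one_of_le₀ (Nat.cast_le.2 htw) w.cast_nonneg)
  calc (1 - t / w : ℝ) ^ (m - t) ≤ Real.exp (-(t / w)) ^ (m - t) := by
        gcongr
        exact Real.one_sub_le_exp_neg _
    _ = Real.exp (-((m - t : ℕ) * (t / w))) := by rw [← Real.exp_nat_mul, mul_neg]
    _ ≤ Real.exp (-(n / 4 * (t / w))) := by gcongr
    _ = Real.exp (-(n / (4 * w))) ^ t := by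
      rw [← Real.exp_nat_mul]
      ring_nf

lemma choose_mul_choose_mul_pow_le_exp_neg (hwn : w ≤ n) (hmn : m ≤ n) (hnm : n ≤ 2 * m)
    (htn : 4 * t ≤ n) (hexp : Real.exp 3 * (n / t) ^ 2 ≤ Real.exp (n / (4 * w))) :
    (w.choose t : ℝ) * m.choose t * (1 - t / w) ^ (m - t) ≤ Real.exp (-t) := by
  rcases lt_or_ge w t with hwt | htw
  · rw [Nat.choose_eq_zero_of_lt hwt, Nat.cast_zero, zero_mul, zero_mul]
    exact Real.exp_nonneg _
  have hnonneg : (0 : ℝ) ≤ 1 - t / w :=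
    sub_nonneg.2 (div_le_one_of_le₀ (Nat.cast_le.2 htw) w.cast_nonneg)
  have hbase : n / t * Real.exp 1 * (n / t * Real.exp 1) * Real.exp (-(n / (4 * w))) ≤
      Real.exp (-1) := by
    rw [Real.exp_neg (n / (4 * w)), ← div_eq_mul_inv, div_le_iff₀ (Real.exp_pos _)]
    calc n / t * Real.exp 1 * (n / t * Real.exp 1)
        = Real.exp (-1) * (Real.exp 3 * (n / t) ^ 2) := by
          rw [show (3 : ℝ) = 1 + (1 + 1) by norm_num, Real.exp_add, Real.exp_add, Real.exp_neg]
          field_simp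
      _ ≤ Real.exp (-1) * Real.exp (n / (4 * w)) := by gcongr
  calc (w.choose t : ℝ) * m.choose t * (1 - t / w) ^ (m - t)
      ≤ n.choose t * n.choose t * Real.exp (-(n / (4 * w))) ^ t := by
        gcongr ?_ * ?_ * ?_
        exacts [Nat.cast_le.2 (Nat.choose_le_choose t hwn),
          Nat.cast_le.2 (Nat.choose_le_choose t hmn), one_sub_div_pow_sub_le_exp_pow htw hnm htn]
    _ ≤ (n / t * Real.exp 1) ^ t * (n / t * Real.exp 1) ^ t * Real.exp (-(n / (4 * w))) ^ t := by
      gcongr <;> exact choose_le_div_mul_exp_one_pow n t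
    _ = (n / t * Real.exp 1 * (n / t * Real.exp 1) * Real.exp (-(n / (4 * w)))) ^ t := by
      rw [← mul_pow, ← mul_pow]
    _ ≤ Real.exp (-1) ^ t := by gcongr
    _ = Real.exp (-t) := by rw [← Real.exp_nat_mul, mul_neg_one]

end Binomial

section UniformChoices

variable {ι κ : Type*} [Fintype ι] [Fintype κ] [Nonempty κ] [MeasurableSpace κ]

/-- The law of the slots picked by the packets in one execution: independent and uniform. -/
noncomputable def uniformChoices (ι κ : Type*) [Fintype ι] [Fintype κ] [Nonempty κ]
    [MeasurableSpace κ] : Measure (ι → κ) :=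
  Measure.pi fun _ => (PMF.uniformOfFintype κ).toMeasure

instance : IsProbabilityMeasure (uniformChoices ι κ) := by
  unfold uniformChoices
  infer_instance

variable [MeasurableSingletonClass κ]

lemma uniformChoices_real_forall_notMem (F : Finset ι) (T : Finset κ) :
    (uniformChoices ι κ).real {s | ∀ i ∈ F, s i ∉ T} = (1 - #T / Fintype.card κ : ℝ) ^ #F := by
  classical
  have hset : {s : ι → κ | ∀ i ∈ F, s i ∉ T} =
      (F : Set ι).pi fun _ => ((Tᶜ : Finset κ) : Set κ) := by
    ext s
    simp
  rw [hset, uniformChoices, ← Measure.infinitePi_eq_pi, Measure.real,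
    Measure.infinitePi_pi _ fun _ _ => .of_discrete, prod_const,
    PMF.toMeasure_uniformOfFintype_apply _ .of_discrete]
  simp only [coe_sort_coe, Fintype.card_coe, card_compl, ENNReal.toReal_pow, ENNReal.toReal_div,
    ENNReal.toReal_natCast, Nat.cast_sub (card_le_univ T)]
  rw [sub_div, div_self (Nat.cast_ne_zero.2 Fintype.card_ne_zero)]

lemma uniformChoices_real_le_card_collisionFreeSlots_le [DecidableEq κ] {S : Finset ι} {t : ℕ}
    (htS : t ≤ #S) :
    (uniformChoices ι κ).real {s | t ≤ #(collisionFreeSlots S s)} ≤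
      (Fintype.card κ).choose t * (#S).choose t * (1 - t / Fintype.card κ : ℝ) ^ (#S - t) := by
  classical
  let P := (univ : Finset κ).powersetCard t ×ˢ S.powersetCard t
  have hcover : {s : ι → κ | t ≤ #(collisionFreeSlots S s)} ⊆
      ⋃ p ∈ P, {s | ∀ i ∈ S \ p.2, s i ∉ p.1} := by
    intro s hs
    obtain ⟨T, A, hAS, hT, hA, havoid⟩ := exists_slots_avoided_outside htS hs
    refine Set.mem_iUnion₂.2 ⟨(T, A), ?_, fun i hi => ?_⟩
    · simp only [P, mem_product, mem_powersetCard]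
      exact ⟨⟨subset_univ T, hT⟩, hAS, hA⟩
    · exact havoid i (mem_sdiff.1 hi).1 (mem_sdiff.1 hi).2
  have hprob : ∀ p ∈ P, (uniformChoices ι κ).real {s | ∀ i ∈ S \ p.2, s i ∉ p.1} =
      (1 - t / Fintype.card κ : ℝ) ^ (#S - t) := by
    intro p hp
    simp only [P, mem_product, mem_powersetCard] at hp
    rw [uniformChoices_real_forall_notMem, hp.1.2, card_sdiff_of_subset hp.2.1, hp.2.2]
  calc (uniformChoices ι κ).real {s | t ≤ #(collisionFreeSlots S s)}
      ≤ ∑ p ∈ P, (uniformChoices ι κ).real {s | ∀ i ∈ S \ p.2, s i ∉ p.1} :=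
        (measureReal_mono hcover (measure_ne_top _ _)).trans (measureReal_biUnion_finset_le _ _)
    _ = _ := by
      rw [sum_congr rfl hprob, sum_const, card_product, card_powersetCard, card_powersetCard,
        card_univ, nsmul_eq_mul, Nat.cast_mul]

lemma uniformChoices_real_le_card_collisionFreeSlots_le_exp_neg [DecidableEq κ] {S : Finset ι}
    {t : ℕ} (hκι : Fintype.card κ ≤ Fintype.card ι)
    (hS : Fintype.card ι ≤ 2 * #S) (htι : 4 * t ≤ Fintype.card ι)
    (hexp : Real.exp 3 * (Fintype.card ι / t) ^ 2 ≤
      Real.exp (Fintype.card ι / (4 * Fintype.card κ))) :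
    (uniformChoices ι κ).real {s | t ≤ #(collisionFreeSlots S s)} ≤ Real.exp (-t) :=
  (uniformChoices_real_le_card_collisionFreeSlots_le (by lia)).trans
    (choose_mul_choose_mul_pow_le_exp_neg hκι (card_le_univ S) hS htι hexp)

end UniformChoices

section Run

variable {n : ℕ} {reps : ℕ → ℕ}

/-- The packets present before the `j`-th execution (counted from `0`) of the window of size
`2 ^ k`; for `j = reps (2 ^ k)`, those present after the last one. -/
def presentBefore (reps : ℕ → ℕ) (ω : Choices n) (k j : ℕ) : Finset (Fin n) :=
  afterExecutions ω k (presentAt reps ω k) j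

lemma presentBefore_zero_zero (reps : ℕ → ℕ) (ω : Choices n) : presentBefore reps ω 0 0 = univ :=
  rfl

lemma presentBefore_succ_zero (reps : ℕ → ℕ) (ω : Choices n) (k : ℕ) :
    presentBefore reps ω (k + 1) 0 = presentBefore reps ω k (reps (2 ^ k)) :=
  rfl

lemma presentBefore_succ (reps : ℕ → ℕ) (ω : Choices n) (k j : ℕ) :
    presentBefore reps ω k (j + 1) = survivors (presentBefore reps ω k j) (slots ω k j) :=
  rfl

lemma execution_induction (reps : ℕ → ℕ) {P : ℕ → ℕ → Prop} (start : P 0 0)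
    (double : ∀ k, P k (reps (2 ^ k)) → P (k + 1) 0) (execute : ∀ k j, P k j → P k (j + 1))
    (k j : ℕ) : P k j := by
  have all_executions {k : ℕ} (h : P k 0) (j : ℕ) : P k j := by
    induction j with
    | zero => exact h
    | succ j ih => exact execute k j ih
  induction k generalizing j with
  | zero => exact all_executions start j
  | succ k ih => exact all_executions (double k (ih _)) j

section Deterministic

variable {ω : Choices n} {m K M H R t : ℕ}

lemma le_card_presentBefore {loss : ℕ → ℕ}
    (hloss : ∀ k ≤ K, ∀ j < reps (2 ^ k), m ≤ #(presentBefore reps ω k j) →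
      #(presentBefore reps ω k j) ≤ #(presentBefore reps ω k (j + 1)) + loss k)
    (hbudget : m + ∑ k ∈ range (K + 1), reps (2 ^ k) * loss k ≤ n) {k j : ℕ} (hk : k ≤ K)
    (hj : j ≤ reps (2 ^ k)) : m ≤ #(presentBefore reps ω k j) := by
  have spent_le {k j : ℕ} (hk : k ≤ K) (hj : j ≤ reps (2 ^ k)) :
      ∑ i ∈ range k, reps (2 ^ i) * loss i + j * loss k ≤
        ∑ i ∈ range (K + 1), reps (2 ^ i) * loss i := by
    calc _ ≤ ∑ i ∈ range (k + 1), reps (2 ^ i) * loss i := by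
          rw [sum_range_succ]
          gcongr
      _ ≤ _ := by gcongr
  suffices hpresent : n ≤ #(presentBefore reps ω k j) +
      (∑ i ∈ range k, reps (2 ^ i) * loss i + j * loss k) by
    have := spent_le hk hj
    lia
  induction k, j using execution_induction reps with
  | start => simp [presentBefore_zero_zero]
  | double k ih =>
    rw [presentBefore_succ_zero, sum_range_succ, zero_mul, add_zero]
    exact ih (by lia) le_rfl
  | execute k j ih =>
    have hpresent := ih hk (by lia)
    have hspent := spent_le (j := j) hk (by lia)
    have hlost := hloss k hk j hj (by lia)
    rw [Nat.succ_mul]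
    lia

/-- The number of successes allowed in one execution of the window of size `2 ^ k`: all slots but
one up to `k = M`, and only `t` slots after that. Sparing one slot makes the bound vanish at
`k = 0`, where the number of executions is arbitrary. -/
def lossBound (M t k : ℕ) : ℕ := if k ≤ M then 2 ^ k - 1 else t

lemma sum_mul_lossBound_le {r : ℕ → ℕ} (hr : ∀ k, 0 < k → k ≤ M + H → r k ≤ R) :
    ∑ k ∈ range (M + H + 1), r k * lossBound M t k ≤ R * (2 ^ (M + 1) + H * t) := by
  have hterm : ∀ k ∈ range (M + H + 1), r k * lossBound M t k ≤ R * lossBound M t k := by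
    intro k hk
    rcases k.eq_zero_or_pos with rfl | hk0
    · simp [lossBound]
    · exact Nat.mul_le_mul_right _ (hr k hk0 (mem_range_succ_iff.1 hk))
  have hsmall : ∑ k ∈ range (M + 1), lossBound M t k ≤ 2 ^ (M + 1) :=
    calc ∑ k ∈ range (M + 1), lossBound M t k ≤ ∑ k ∈ range (M + 1), 2 ^ k :=
          sum_le_sum fun k hk => by
            rw [lossBound, if_pos (mem_range_succ_iff.1 hk)]
            exact Nat.sub_le _ _
      _ ≤ 2 ^ (M + 1) := (Nat.geomSum_lt le_rfl fun k hk => mem_range.1 hk).le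
  have hlarge : ∑ k ∈ range H, lossBound M t (M + 1 + k) = H * t := by
    have hbound : ∀ k ∈ range H, lossBound M t (M + 1 + k) = t := fun k _ => if_neg (by lia)
    rw [sum_congr rfl hbound, sum_const, card_range, smul_eq_mul]
  calc ∑ k ∈ range (M + H + 1), r k * lossBound M t k
      ≤ R * ∑ k ∈ range (M + 1 + H), lossBound M t k := by
        rw [mul_sum, add_right_comm]
        exact sum_le_sum (by rwa [add_right_comm] at hterm)
    _ ≤ R * (2 ^ (M + 1) + H * t) := by
        rw [sum_range_add, hlarge]
        gcongr

lemma card_presentBefore_le_add_lossBound {k j : ℕ} (hM : 2 ^ M < #(presentBefore reps ω k j))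
    (hfree : M < k → #(collisionFreeSlots (presentBefore reps ω k j) (slots ω k j)) ≤ t) :
    #(presentBefore reps ω k j) ≤ #(presentBefore reps ω k (j + 1)) + lossBound M t k := by
  have hsuccesses := card_le_card_survivors_add_card_collisionFreeSlots
    (presentBefore reps ω k j) (slots ω k j)
  rw [← presentBefore_succ] at hsuccesses
  unfold lossBound
  split_ifs with hk
  · have hpow : 2 ^ k ≤ 2 ^ M := Nat.pow_le_pow_right two_pos hk
    have hlt := card_collisionFreeSlots_lt_of_card_lt (s := slots ω k j)
      (by rw [Fintype.card_fin]; exact hpow.trans_lt hM)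
    rw [Fintype.card_fin] at hlt
    lia
  · have := hfree (not_le.1 hk)
    lia

lemma reps_mul_le_totalCollisions (hMK : M < K) (hMm : 2 ^ M < m)
    (hfree : ∀ k ∈ Ioc M K, ∀ j < reps (2 ^ k), m ≤ #(presentBefore reps ω k j) →
      #(collisionFreeSlots (presentBefore reps ω k j) (slots ω k j)) ≤ t)
    (hbudget : m + ∑ k ∈ range (K + 1), reps (2 ^ k) * lossBound M t k ≤ n) :
    ((reps (2 ^ K) * (2 ^ K - t) : ℕ) : ENNReal) ≤ totalCollisions reps ω := by
  have hpresent {j : ℕ} (hj : j < reps (2 ^ K)) : m ≤ #(presentBefore reps ω K j) :=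
    le_card_presentBefore (fun k hk j hj hm => card_presentBefore_le_add_lossBound
      (hMm.trans_le hm) fun hMk => hfree k (mem_Ioc.2 ⟨hMk, hk⟩) j hj hm) hbudget le_rfl hj.le
  have hcollisions : ∀ j ∈ range (reps (2 ^ K)),
      2 ^ K - t ≤ collisions (presentBefore reps ω K j) (slots ω K j) := by
    intro j hj
    rw [mem_range] at hj
    have := hfree K (right_mem_Ioc.2 hMK) j hj (hpresent hj)
    have := collisions_add_card_collisionFreeSlots (presentBefore reps ω K j) (slots ω K j)
    lia
  calc ((reps (2 ^ K) * (2 ^ K - t) : ℕ) : ENNReal)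
      ≤ ((∑ j ∈ range (reps (2 ^ K)), collisions (presentBefore reps ω K j) (slots ω K j) : ℕ) :
          ENNReal) := by
        rw [Nat.cast_le]
        simpa only [card_range, smul_eq_mul] using card_nsmul_le_sum _ _ _ hcollisions
    _ ≤ totalCollisions reps ω := by
      rw [Nat.cast_sum]
      exact ENNReal.le_tsum K

end Deterministic

end Run

section EventBounds

lemma one_sub_sum_measureReal_not_le {Ω ι : Type*} {mΩ : MeasurableSpace Ω} (μ : Measure Ω)
    [IsProbabilityMeasure μ] (I : Finset ι) (p : ι → Ω → Prop) :
    1 - ∑ i ∈ I, μ.real {ω | ¬p i ω} ≤ μ.real {ω | ∀ i ∈ I, p i ω} := by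
  have hcover : Set.univ ⊆ {ω | ∀ i ∈ I, p i ω} ∪ ⋃ i ∈ I, {ω | ¬p i ω} := by
    intro ω _
    by_contra! h
    simp only [Set.mem_union, Set.mem_ofPred_eq, Set.mem_iUnion, not_or, not_exists, not_not] at h
    exact h.1 h.2
  have htotal : μ.real Set.univ ≤ _ :=
    (measureReal_mono hcover (measure_ne_top μ _)).trans (measureReal_union_le _ _)
  have hfails := measureReal_biUnion_finset_le (μ := μ) I fun i => {ω | ¬p i ω}
  rw [probReal_univ] at htotal
  linarith

lemma measureReal_mem_le_of_indepFun {Ω α β : Type*} {mΩ : MeasurableSpace Ω}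
    {mα : MeasurableSpace α} {mβ : MeasurableSpace β} {μ : Measure Ω} [IsProbabilityMeasure μ]
    {X : Ω → α} {Y : Ω → β} (hX : Measurable X) (hY : Measurable Y) (hXY : IndepFun X Y μ)
    {A : Set (α × β)} (hA : MeasurableSet A) {ε : ℝ}
    (hε : ∀ x, μ.real {ω | (x, Y ω) ∈ A} ≤ ε) : μ.real {ω | (X ω, Y ω) ∈ A} ≤ ε := by
  have := Measure.isProbabilityMeasure_map (μ := μ) hX.aemeasurable
  have := Measure.isProbabilityMeasure_map (μ := μ) hY.aemeasurable
  have hε0 : 0 ≤ ε := by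
    obtain ⟨ω⟩ := nonempty_of_isProbabilityMeasure μ
    exact measureReal_nonneg.trans (hε (X ω))
  have hslice (x : α) : μ.map Y (Prod.mk x ⁻¹' A) ≤ ENNReal.ofReal ε := by
    rw [Measure.map_apply hY (measurable_prodMk_left hA)]
    exact (ENNReal.le_ofReal_iff_toReal_le (measure_ne_top _ _) hε0).2 (hε x)
  refine ENNReal.toReal_le_of_le_ofReal hε0 ?_
  calc μ {ω | (X ω, Y ω) ∈ A} = (μ.map X).prod (μ.map Y) A := by
        rw [← (indepFun_iff_map_prod_eq_prod_map_map hX.aemeasurable hY.aemeasurable).1 hXY,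
          Measure.map_apply (hX.prodMk hY) hA]
        rfl
    _ = ∫⁻ x, μ.map Y (Prod.mk x ⁻¹' A) ∂μ.map X := Measure.prod_apply hA
    _ ≤ ∫⁻ _, ENNReal.ofReal ε ∂μ.map X := lintegral_mono hslice
    _ = ENNReal.ofReal ε := by rw [lintegral_const, measure_univ, mul_one]

end EventBounds

section Independence

variable {n : ℕ}

instance : IsProbabilityMeasure (law n) := by
  unfold law
  infer_instance

lemma iIndepFun_eval_law : iIndepFun (fun q (ω : Choices n) => ω q) (law n) :=
  iIndepFun_infinitePi (X := fun _ => id) fun _ => measurable_id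

lemma measurable_slots (k j : ℕ) : Measurable fun ω : Choices n => slots ω k j :=
  measurable_pi_lambda _ fun i => measurable_pi_apply (k, j, i)

lemma map_slots_law (k j : ℕ) :
    (law n).map (fun ω => slots ω k j) = uniformChoices (Fin n) (Fin (2 ^ k)) := by
  have hinj : Function.Injective fun i : Fin n => (k, j, i) := fun i i' h => by simpa using h
  have hmap := (iIndepFun_iff_map_fun_eq_pi_map fun i =>
    (measurable_pi_apply (k, j, i)).aemeasurable).1 (iIndepFun_eval_law.precomp hinj)
  refine hmap.trans ?_
  unfold uniformChoices law
  congr 1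
  funext i
  exact Measure.infinitePi_map_eval _ (k, j, i)

/-- The information in the choices made before the `j`-th execution of the window of size
`2 ^ k`. -/
abbrev past (n k j : ℕ) : MeasurableSpace (Choices n) :=
  ⨆ q ∈ {q : ℕ × ℕ × Fin n | q.1 < k ∨ q.1 = k ∧ q.2.1 < j},
    MeasurableSpace.comap (fun ω => ω q) inferInstance

lemma past_le (k j : ℕ) : past n k j ≤ MeasurableSpace.pi :=
  iSup₂_le fun q _ => (measurable_pi_apply q).comap_le

lemma past_mono {k j k' j' : ℕ} (h : k < k' ∨ k = k' ∧ j ≤ j') : past n k j ≤ past n k' j' := by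
  refine biSup_mono fun q hq => ?_
  rw [Set.mem_ofPred_eq] at hq ⊢
  lia

lemma measurable_past_slots (k j : ℕ) :
    Measurable[past n k (j + 1)] fun ω : Choices n => slots ω k j := by
  refine @measurable_pi_lambda _ _ _ (past n k (j + 1)) _ _ fun i => ?_
  refine measurable_iff_comap_le.2 (le_iSup₂_of_le (k, j, i) ?_ le_rfl)
  exact Or.inr ⟨rfl, j.lt_succ_self⟩

lemma measurable_past_presentBefore (reps : ℕ → ℕ) (k j : ℕ) :
    Measurable[past n k j] fun ω => presentBefore reps ω k j := by
  induction k, j using execution_induction reps with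
  | start => exact @measurable_const _ _ _ (past n 0 0) _
  | double k ih => exact ih.mono (past_mono (.inl k.lt_succ_self)) le_rfl
  | execute k j ih =>
    have hpresent := ih.mono (past_mono (.inr ⟨rfl, j.le_succ⟩)) le_rfl
    have hpair := hpresent.prodMk (measurable_past_slots k j)
    exact (Measurable.of_discrete (f := fun p : Finset (Fin n) × (Fin n → Fin (2 ^ k)) =>
      survivors p.1 p.2)).comp hpair

lemma indepFun_presentBefore_slots (reps : ℕ → ℕ) (k j : ℕ) :
    IndepFun (fun ω => presentBefore reps ω k j) (fun ω => slots ω k j) (law n) := by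
  have hdisjoint : Disjoint {q : ℕ × ℕ × Fin n | q.1 < k ∨ q.1 = k ∧ q.2.1 < j}
      {q | q.1 = k ∧ q.2.1 = j} := by
    refine Set.disjoint_left.2 fun q hq hq' => ?_
    rw [Set.mem_ofPred_eq] at hq hq'
    lia
  have hindep := indep_iSup_of_disjoint (fun q => (measurable_pi_apply q).comap_le)
    (iIndepFun_eval_law (n := n)) hdisjoint
  refine (IndepFun_iff_Indep _ _ _).2 (indep_of_indep_of_le_left (indep_of_indep_of_le_right hindep
    ?_) (measurable_past_presentBefore reps k j).comap_le)
  refine measurable_iff_comap_le.1 ?_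
  refine @measurable_pi_lambda _ _ _ (_) _ _ fun i => ?_
  exact measurable_iff_comap_le.2 (le_iSup₂_of_le (k, j, i) ⟨rfl, rfl⟩ le_rfl)

end Independence

section LastWindow

variable {n : ℕ} {reps : ℕ → ℕ} {k j m M H R t : ℕ}

/-- If at least `m` packets are present before the `j`-th execution of the window of size `2 ^ k`,
then fewer than `t` of its slots are without a collision. -/
def FewCollisionFreeSlots (reps : ℕ → ℕ) (m t k j : ℕ) (ω : Choices n) : Prop :=
  m ≤ #(presentBefore reps ω k j) →
    #(collisionFreeSlots (presentBefore reps ω k j) (slots ω k j)) < t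

lemma law_real_not_fewCollisionFreeSlots_le (reps : ℕ → ℕ) (hkn : 2 ^ k ≤ n) (hnm : n ≤ 2 * m)
    (htn : 4 * t ≤ n) (hexp : Real.exp 3 * (n / t : ℝ) ^ 2 ≤ Real.exp (n / (4 * 2 ^ k))) :
    (law n).real {ω | ¬FewCollisionFreeSlots reps m t k j ω} ≤ Real.exp (-t) := by
  refine measureReal_mem_le_of_indepFun
    (A := {p : Finset (Fin n) × (Fin n → Fin (2 ^ k)) |
      ¬(m ≤ #p.1 → #(collisionFreeSlots p.1 p.2) < t)})
    ((measurable_past_presentBefore reps k j).mono (past_le k j) le_rfl) (measurable_slots k j)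
    (indepFun_presentBefore_slots reps k j) .of_discrete fun S => ?_
  rcases lt_or_ge #S m with hS | hS
  · simp [hS.not_ge, Real.exp_nonneg]
  simp only [Set.mem_ofPred_eq, hS, true_imp_iff, not_lt]
  calc (law n).real {ω | t ≤ #(collisionFreeSlots S (slots ω k j))}
      = (uniformChoices (Fin n) (Fin (2 ^ k))).real {s | t ≤ #(collisionFreeSlots S s)} := by
        rw [← map_slots_law k j, map_measureReal_apply (measurable_slots k j) .of_discrete]
        rfl
    _ ≤ Real.exp (-t) := by
      apply uniformChoices_real_le_card_collisionFreeSlots_le_exp_neg <;>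
        simp only [Fintype.card_fin, Nat.cast_pow, Nat.cast_ofNat]
      exacts [hkn, by lia, htn, hexp]

lemma one_sub_le_law_real_forall_fewCollisionFreeSlots
    (hreps : ∀ k, 0 < k → k ≤ M + H → reps (2 ^ k) ≤ R) (hn : 2 ^ (M + H) ≤ n) (hnm : n ≤ 2 * m)
    (htn : 4 * t ≤ n)
    (hexp : Real.exp 3 * (n / t : ℝ) ^ 2 ≤ Real.exp (n / (4 * 2 ^ (M + H)))) :
    1 - H * R * Real.exp (-t) ≤ (law n).real
      {ω | ∀ q ∈ (Ioc M (M + H)).sigma fun k => range (reps (2 ^ k)),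
        FewCollisionFreeSlots reps m t q.1 q.2 ω} := by
  let executions := (Ioc M (M + H)).sigma fun k => range (reps (2 ^ k))
  have hcard : #executions ≤ H * R := by
    rw [card_sigma]
    refine (sum_le_card_nsmul _ _ R fun k hk => ?_).trans_eq ?_
    · rw [mem_Ioc] at hk
      rw [card_range]
      exact hreps k (by lia) hk.2
    · rw [Nat.card_Ioc, Nat.add_sub_cancel_left, smul_eq_mul]
  have hfails : ∀ q ∈ executions,
      (law n).real {ω | ¬FewCollisionFreeSlots reps m t q.1 q.2 ω} ≤ Real.exp (-t) := by
    intro q hq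
    have hqK : q.1 ≤ M + H := (mem_Ioc.1 (mem_sigma.1 hq).1).2
    refine law_real_not_fewCollisionFreeSlots_le reps
      ((Nat.pow_le_pow_right two_pos hqK).trans hn) hnm htn (hexp.trans ?_)
    gcongr
    exact one_le_two
  calc 1 - H * R * Real.exp (-t)
      ≤ 1 - ∑ q ∈ executions, (law n).real {ω | ¬FewCollisionFreeSlots reps m t q.1 q.2 ω} := by
        have hsum := sum_le_card_nsmul _ _ _ hfails
        rw [nsmul_eq_mul] at hsum
        have hcard_real : (#executions : ℝ) ≤ H * R := by exact_mod_cast hcard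
        have := mul_le_mul_of_nonneg_right hcard_real (Real.exp_nonneg (-t))
        linarith
    _ ≤ _ := one_sub_sum_measureReal_not_le _ _ _

lemma ofReal_one_sub_le_law_reps_mul_le_totalCollisions (hH : 0 < H)
    (hreps : ∀ k, 0 < k → k ≤ M + H → reps (2 ^ k) ≤ R) (hn : 2 * 2 ^ (M + H) ≤ n)
    (hbudget : 2 * (R * (2 ^ (M + 1) + H * t)) ≤ n) (htn : 4 * t ≤ n)
    (hexp : Real.exp 3 * (n / t : ℝ) ^ 2 ≤ Real.exp (n / (4 * 2 ^ (M + H)))) :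
    ENNReal.ofReal (1 - H * R * Real.exp (-t)) ≤
      law n {ω | ((reps (2 ^ (M + H)) * (2 ^ (M + H) - t) : ℕ) : ENNReal) ≤
        totalCollisions reps ω} := by
  have hfew := one_sub_le_law_real_forall_fewCollisionFreeSlots (m := n - n / 2) (M := M) hreps
    (by lia) (by lia) htn hexp
  refine (ENNReal.ofReal_le_of_le_toReal hfew).trans (measure_mono fun ω hω => ?_)
  have hpow : 2 ^ M < 2 ^ (M + H) := Nat.pow_lt_pow_right one_lt_two (by lia)
  have hlosses := sum_mul_lossBound_le (t := t) hreps
  exact reps_mul_le_totalCollisions (m := n - n / 2) (by lia : M < M + H) (by lia)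
    (fun k hk j hj hm => (hω ⟨k, j⟩ (mem_sigma.2 ⟨hk, mem_range.2 hj⟩) hm).le) (by lia)

end LastWindow

section BaseTwoLogarithm

lemma lg_two_pow (k : ℕ) : lg (2 ^ k) = k := by
  rw [lg, Real.logb_pow, Real.logb_self_eq_one one_lt_two, mul_one]

lemma lg_le_lg {x y : ℝ} (hx : 0 < x) (hxy : x ≤ y) : lg x ≤ lg y :=
  Real.logb_le_logb_of_le one_lt_two hx hxy

lemma log_le_lg {x : ℝ} (hx : 1 ≤ x) : Real.log x ≤ lg x :=
  le_div_self (Real.log_nonneg hx) (Real.log_pos one_lt_two) (by linarith [Real.log_two_lt_d9])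

lemma tendsto_lg_atTop : Tendsto lg atTop atTop :=
  Real.tendsto_logb_atTop one_lt_two

lemma eventually_mul_lg_pow_le (c : ℝ) (m : ℕ) : ∀ᶠ x in atTop, c * lg x ^ m ≤ x := by
  have hlittle : (fun x => c * lg x ^ m) =o[atTop] id :=
    (Real.isLittleO_pow_logb_id_atTop (b := 2)).const_mul_left c
  filter_upwards [hlittle.bound one_pos, eventually_ge_atTop 0] with x hx hx0
  rw [one_mul, id, Real.norm_of_nonneg hx0] at hx
  exact (le_abs_self _).trans hx

variable {reps : ℕ → ℕ} {k : ℕ} {x : ℝ}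

lemma IsLogLog.abs_reps_two_pow_sub_lg_le (h : IsLogLog reps) (hk : 0 < k) :
    |(reps (2 ^ k) : ℝ) - lg k| ≤ 1 := by
  have hround := h (2 ^ k) (Nat.le_self_pow hk.ne' 2)
  rwa [Nat.cast_pow, Nat.cast_two, lg_two_pow] at hround

lemma IsLogLog.reps_two_pow_le_lg_lg_add_one (h : IsLogLog reps) (hk : 0 < k) (hkx : 2 ^ k ≤ x) :
    reps (2 ^ k) ≤ lg (lg x) + 1 := by
  have hround := (abs_le.1 (h.abs_reps_two_pow_sub_lg_le hk)).2
  have hkx : (k : ℝ) ≤ lg x := (lg_two_pow k).symm.trans_le (lg_le_lg (by positivity) hkx)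
  have := lg_le_lg (Nat.cast_pos.2 hk) hkx
  linarith

lemma IsLogLog.lg_lg_sub_two_le_reps_two_pow (h : IsLogLog reps) {c : ℝ} (hx : 1 < x) (hc : 0 < c)
    (hcx : 2 * lg c ≤ lg x) (hxk : x ≤ c * 2 ^ k) : lg (lg x) - 2 ≤ reps (2 ^ k) := by
  have hlg : 0 < lg x := Real.logb_pos one_lt_two hx
  have hk : lg x / 2 ≤ k := by
    have hlgk : lg x ≤ lg c + k :=
      calc lg x ≤ lg (c * 2 ^ k) := lg_le_lg (by linarith) hxk
        _ = lg c + k := by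
          rw [← lg_two_pow k, lg, Real.logb_mul hc.ne' (by positivity)]
          rfl
    linarith
  have hk0 : 0 < k := by exact_mod_cast (by linarith : (0 : ℝ) < k)
  have hround := (abs_le.1 (h.abs_reps_two_pow_sub_lg_le hk0)).1
  have hlgk : lg (lg x) - 1 ≤ lg k :=
    calc lg (lg x) - 1 = lg (lg x / 2) := by
          rw [lg.eq_1 (lg x / 2), Real.logb_div hlg.ne' two_ne_zero,
            Real.logb_self_eq_one one_lt_two]
          rfl
      _ ≤ lg k := lg_le_lg (by linarith) hk
  linarith

end BaseTwoLogarithm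

section Parameters

variable {x l : ℝ}

lemma exists_nat_mul_le_and_le_two_mul {b : ℝ} (hb : 0 < b) (hbx : b ≤ x) :
    ∃ t : ℕ, t * b ≤ x ∧ x ≤ 2 * b * t := by
  have hx : 0 ≤ x := hb.le.trans hbx
  refine ⟨⌊x / b⌋₊, (le_div_iff₀ hb).1 (Nat.floor_le (by positivity)), ?_⟩
  have hone : (1 : ℝ) ≤ ⌊x / b⌋₊ := by
    exact_mod_cast Nat.le_floor (by rwa [Nat.cast_one, one_le_div hb])
  have hlt := (div_lt_iff₀ hb).1 (Nat.lt_floor_add_one (x / b))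
  nlinarith

lemma exists_window_exponents (hL : 0 < lg l) (hl : 0 < l) (hx : 40 * lg l * l ≤ x) :
    ∃ M H : ℕ, 0 < H ∧ (H : ℝ) ≤ lg l + 1 ∧ 20 * lg l * 2 ^ (M + H) ≤ x ∧
      x ≤ 40 * lg l * 2 ^ (M + H) ∧ 20 * lg l * l * 2 ^ M ≤ x := by
  set H := ⌈lg l⌉₊
  have hl_le : l ≤ 2 ^ H := by
    rw [← Real.logb_le_logb one_lt_two hl (by positivity)]
    exact (Nat.le_ceil (lg l)).trans_eq (lg_two_pow H).symm
  have hle_l : (2 : ℝ) ^ H ≤ 2 * l := by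
    rw [← Real.logb_le_logb one_lt_two (by positivity) (by positivity),
      Real.logb_mul two_ne_zero hl.ne', Real.logb_self_eq_one one_lt_two, add_comm]
    exact (lg_two_pow H).trans_le (Nat.ceil_lt_add_one hL.le).le
  obtain ⟨M, hM, hM'⟩ := exists_nat_pow_near (x := x / (20 * lg l * 2 ^ H)) (y := 2)
    ((one_le_div (by positivity)).2 (by nlinarith)) one_lt_two
  rw [le_div_iff₀ (by positivity)] at hM
  rw [div_lt_iff₀ (by positivity), pow_succ] at hM'
  refine ⟨M, H, Nat.ceil_pos.2 hL, (Nat.ceil_lt_add_one hL.le).le, ?_, ?_, ?_⟩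
  · rw [pow_add]
    linarith
  · rw [pow_add]
    linarith
  · calc 20 * lg l * l * 2 ^ M ≤ 20 * lg l * 2 ^ H * 2 ^ M := by gcongr
      _ ≤ x := by linarith

lemma two_mul_losses_le {L r h p t : ℝ} (hL : 3 ≤ L) (hLl : 100 * L ≤ l) (hr : r ≤ l + 1)
    (hh : h ≤ L + 1) (hp0 : 0 ≤ p) (hp : 20 * L * l * p ≤ x) (ht0 : 0 ≤ t)
    (ht : t * l ^ 2 ≤ x) (hh0 : 0 ≤ h) : 2 * (r * (2 * p + h * t)) ≤ x := by
  have hl0 : 0 < l := by linarith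
  have hlp : 60 * (l * p) ≤ x :=
    calc 60 * (l * p) = 20 * 3 * (l * p) := by ring
      _ ≤ 20 * L * (l * p) := by gcongr
      _ ≤ x := by linarith
  have hLlt : 100 * (L * l * t) ≤ x :=
    calc 100 * (L * l * t) = 100 * L * (l * t) := by ring
      _ ≤ l * (l * t) := by gcongr
      _ = t * l ^ 2 := by ring
      _ ≤ x := ht
  calc 2 * (r * (2 * p + h * t)) ≤ 2 * (2 * l * (2 * p + 2 * L * t)) := by
        gcongr <;> linarith
    _ = 8 * (l * p) + 8 * (L * l * t) := by ring
    _ ≤ x := by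
      have : 0 ≤ l * p := by positivity
      have : 0 ≤ L * l * t := by positivity
      linarith

lemma exp_three_mul_div_sq_le_exp_div {t w : ℝ} (hl : 108 ≤ l) (ht : 0 < t) (hx : 0 ≤ x)
    (hxt : x ≤ 2 * l ^ 2 * t) (hw : 0 < w) (hwx : 20 * lg l * w ≤ x) :
    Real.exp 3 * (x / t) ^ 2 ≤ Real.exp (x / (4 * w)) := by
  have hexp : Real.exp 3 ≤ 27 := by
    calc Real.exp 3 = Real.exp 1 ^ 3 := by rw [Real.exp_one_pow, Nat.cast_ofNat]
      _ ≤ 3 ^ 3 := by gcongr; exact Real.exp_one_lt_three.le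
      _ = 27 := by norm_num
  have hratio : x / t ≤ 2 * l ^ 2 := (div_le_iff₀ ht).2 hxt
  calc Real.exp 3 * (x / t) ^ 2 ≤ 27 * (2 * l ^ 2) ^ 2 := by gcongr
    _ = 108 * l ^ 4 := by ring
    _ ≤ l * l ^ 4 := by gcongr
    _ = Real.exp (Real.log l) ^ 5 := by
      rw [Real.exp_log (by linarith)]
      ring
    _ = Real.exp (5 * Real.log l) := by rw [← Real.exp_nat_mul, Nat.cast_ofNat]
    _ ≤ Real.exp (5 * lg l) := by
      gcongr
      exact log_le_lg (by linarith)
    _ ≤ Real.exp (x / (4 * w)) := by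
      gcongr
      rw [le_div_iff₀ (by positivity)]
      linarith

lemma mul_exp_neg_le_one_div_rpow {a c t : ℝ} (ha : 0 ≤ a + 1) (hx : 1 ≤ x) (hc : c ≤ x)
    (ht : (a + 1) * lg x ≤ t) : c * Real.exp (-t) ≤ 1 / x ^ a := by
  have hx0 : 0 < x := by linarith
  have hlog : (a + 1) * Real.log x ≤ t :=
    (mul_le_mul_of_nonneg_left (log_le_lg hx) ha).trans ht
  calc c * Real.exp (-t) ≤ Real.exp (Real.log x) * Real.exp (-((a + 1) * Real.log x)) := by
        rw [Real.exp_log hx0]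
        gcongr
    _ = Real.exp (-(Real.log x * a)) := by
      rw [← Real.exp_add]
      ring_nf
    _ = 1 / x ^ a := by rw [Real.exp_neg, Real.rpow_def_of_pos hx0, one_div]

lemma mul_div_le_reps_mul_sub {r t w : ℕ} {L : ℝ} (hL : 3 ≤ L) (hLl : 100 * L ≤ l)
    (hw : x ≤ 40 * L * w) (htl : t * l ^ 2 ≤ x) (hr : l / 2 ≤ r) :
    1 / 160 * (x * l / L) ≤ ((r * (w - t) : ℕ) : ℝ) := by
  have hl0 : 0 < l := by linarith
  have htw : (t : ℝ) ≤ w / 2 := by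
    have hLl2 : 80 * L ≤ l ^ 2 := by nlinarith
    have htL : t * (80 * L) ≤ x := le_trans (by gcongr) htl
    refine le_of_mul_le_mul_right (a := 80 * L) ?_ (by positivity)
    linarith
  have htw_nat : t ≤ w := by
    exact_mod_cast htw.trans (half_le_self w.cast_nonneg)
  rw [Nat.cast_mul, Nat.cast_sub htw_nat]
  calc 1 / 160 * (x * l / L) ≤ 1 / 160 * (40 * L * w * l / L) := by gcongr
    _ = l / 2 * (w / 2) := by
      field_simp
      ring
    _ ≤ r * (w - t) := by
      gcongr
      linarith

variable {n : ℕ} {reps : ℕ → ℕ}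

lemma IsLogLog.ofReal_one_sub_le_law {M H t : ℕ} (hreps : IsLogLog reps)
    (hL : 3 ≤ lg (lg (lg n))) (hLl : 100 * lg (lg (lg n)) ≤ lg (lg n)) (hH : 0 < H)
    (hHL : H ≤ lg (lg (lg n)) + 1) (hKn : 20 * lg (lg (lg n)) * 2 ^ (M + H) ≤ n)
    (hMn : 20 * lg (lg (lg n)) * lg (lg n) * 2 ^ M ≤ n) (ht : 0 < t)
    (htn : t * lg (lg n) ^ 2 ≤ n) (hnt : n ≤ 2 * lg (lg n) ^ 2 * t) :
    ENNReal.ofReal (1 - H * (lg (lg n) + 1) * Real.exp (-t)) ≤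
      law n {ω | ((reps (2 ^ (M + H)) * (2 ^ (M + H) - t) : ℕ) : ENNReal) ≤
        totalCollisions reps ω} := by
  set l := lg (lg n)
  have hR : (⌊l + 1⌋₊ : ℝ) ≤ l + 1 := Nat.floor_le (by linarith)
  have htwoK : (2 * 2 ^ (M + H) : ℝ) ≤ n :=
    (mul_le_mul_of_nonneg_right (by linarith) (by positivity)).trans hKn
  have hreps_le : ∀ k, 0 < k → k ≤ M + H → reps (2 ^ k) ≤ ⌊l + 1⌋₊ := fun k hk hkK =>
    Nat.le_floor <| hreps.reps_two_pow_le_lg_lg_add_one hk <|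
      calc (2 : ℝ) ^ k ≤ 2 ^ (M + H) := pow_le_pow_right₀ one_le_two hkK
        _ ≤ 2 * 2 ^ (M + H) := le_mul_of_one_le_left (by positivity) one_le_two
        _ ≤ n := htwoK
  have hbudget : 2 * (⌊l + 1⌋₊ * (2 ^ (M + 1) + H * t : ℝ)) ≤ n := by
    rw [pow_succ']
    exact two_mul_losses_le hL hLl hR hHL (by positivity) hMn t.cast_nonneg htn H.cast_nonneg
  have hfour : (4 * t : ℝ) ≤ n :=
    calc (4 * t : ℝ) ≤ l ^ 2 * t := by gcongr; nlinarith
      _ ≤ n := by linarith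
  have hexp : Real.exp 3 * (n / t : ℝ) ^ 2 ≤ Real.exp (n / (4 * 2 ^ (M + H))) :=
    exp_three_mul_div_sq_le_exp_div (by linarith) (Nat.cast_pos.2 ht) n.cast_nonneg hnt
      (by positivity) hKn
  refine le_trans (by gcongr) (ofReal_one_sub_le_law_reps_mul_le_totalCollisions hH hreps_le
    (by exact_mod_cast htwoK) (by exact_mod_cast hbudget) (by exact_mod_cast hfour) hexp)

lemma IsLogLog.ofReal_one_sub_one_div_rpow_le_law {a : ℝ} (hreps : IsLogLog reps) (ha : 0 < a)
    (hL : 3 ≤ lg (lg (lg n))) (hLl : 100 * lg (lg (lg n)) ≤ lg (lg n))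
    (hly : 100 * lg (lg n) ≤ lg n) (hyn : 2 * (a + 1) * lg n ^ 3 ≤ n) :
    ENNReal.ofReal (1 - 1 / (n : ℝ) ^ a) ≤
      law n {ω | ENNReal.ofReal (1 / 160 * (n * lg (lg n) / lg (lg (lg n)))) ≤
        totalCollisions reps ω} := by
  set y := lg n
  set l := lg y
  set L := lg l
  have hl : 0 < l := by linarith
  have hay : 1 ≤ (a + 1) * y := by nlinarith
  have hlyn : 2 * l ^ 2 * ((a + 1) * y) ≤ n :=
    calc 2 * l ^ 2 * ((a + 1) * y) ≤ 2 * y ^ 2 * ((a + 1) * y) := by gcongr; linarith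
      _ = 2 * (a + 1) * y ^ 3 := by ring
      _ ≤ n := hyn
  have hln : 2 * l ^ 2 ≤ n := (le_mul_of_one_le_right (by positivity) hay).trans hlyn
  have hn : 1 < (n : ℝ) := by nlinarith
  obtain ⟨t, htn, hnt⟩ := exists_nat_mul_le_and_le_two_mul (x := n) (b := l ^ 2) (by positivity)
    (by linarith [sq_nonneg l])
  obtain ⟨M, H, hH, hHL, hKn, hnK, hMn⟩ := exists_window_exponents (x := n) (l := l) (by linarith)
    hl (by nlinarith)
  have ht : (a + 1) * y ≤ t := le_of_mul_le_mul_left (hlyn.trans hnt) (by positivity)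
  have hfail : H * (l + 1) * Real.exp (-t) ≤ 1 / (n : ℝ) ^ a := by
    refine mul_exp_neg_le_one_div_rpow (by linarith) hn.le ?_ ht
    calc H * (l + 1) ≤ l * (2 * l) := by gcongr <;> linarith
      _ ≤ n := by linarith
  have hlast : l - 2 ≤ reps (2 ^ (M + H)) := by
    refine hreps.lg_lg_sub_two_le_reps_two_pow hn (by positivity) ?_ hnK
    have := lg_le_lg (x := 40 * L) (y := l) (by positivity) (by linarith)
    linarith
  have hcollisions := mul_div_le_reps_mul_sub (w := 2 ^ (M + H)) hL hLl (by exact_mod_cast hnK)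
    htn (by linarith : l / 2 ≤ reps (2 ^ (M + H)))
  calc ENNReal.ofReal (1 - 1 / (n : ℝ) ^ a)
      ≤ ENNReal.ofReal (1 - H * (l + 1) * Real.exp (-t)) := by gcongr
    _ ≤ _ := hreps.ofReal_one_sub_le_law hL hLl hH hHL hKn hMn
      (by exact_mod_cast zero_lt_one.trans_le (hay.trans ht)) htn hnt
    _ ≤ _ := measure_mono fun ω hω => by
      rw [Set.mem_ofPred_eq, ← ENNReal.ofReal_natCast] at hω
      exact (ENNReal.ofReal_le_ofReal hcollisions).trans hω

end Parameters

end LogLogBackoff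

theorem mainTheorem2 :
    ∃ C : ℝ, 0 < C ∧ ∀ a : ℝ, 0 < a → ∃ N : ℕ,
      ∀ reps : ℕ → ℕ, LogLogBackoff.IsLogLog reps → ∀ n : ℕ, N ≤ n →
        ENNReal.ofReal (1 - 1 / (n : ℝ) ^ a) ≤
          LogLogBackoff.law n
            {ω | ENNReal.ofReal (C * (n * lg (lg n) / lg (lg (lg n)))) ≤
              LogLogBackoff.totalCollisions reps ω} := by
  refine ⟨1 / 160, by norm_num, fun a ha => ?_⟩
  have hn := tendsto_natCast_atTop_atTop (R := ℝ)
  have hlg := LogLogBackoff.tendsto_lg_atTop.comp hn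
  have hlglg := LogLogBackoff.tendsto_lg_atTop.comp hlg
  have hlglglg := LogLogBackoff.tendsto_lg_atTop.comp hlglg
  obtain ⟨N, hN⟩ := Filter.eventually_atTop.1 <|
    (hlglglg.eventually_ge_atTop 3).and <|
      (hlglg.eventually (LogLogBackoff.eventually_mul_lg_pow_le 100 1)).and <|
        (hlg.eventually (LogLogBackoff.eventually_mul_lg_pow_le 100 1)).and <|
          hn.eventually (LogLogBackoff.eventually_mul_lg_pow_le (2 * (a + 1)) 3)
  refine ⟨N, fun reps hreps n hNn => ?_⟩
  obtain ⟨hL, hLl, hly, hyn⟩ := hN n hNn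
  rw [pow_one] at hLl hly
  exact hreps.ofReal_one_sub_one_div_rpow_le_law ha hL hLl hly hyn
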